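/- Consider the complex Grassmann algebra with ten anticommuting generators $x_{ijk}$, $1\le i<j<k\le5$, one for each triangle with vertices among $1,\dots,5$. The Berezin integral $\int\cdot\,\mathrm dx_t$ is the right derivative with respect to $x_t$, and multiple integrals are iterated: $\iint f\,\mathrm dy\,\mathrm dx=\int\bigl(\int f\,\mathrm dy\bigr)\mathrm dx$. For each of the five tetrahedra $ijkl$ let $a,b_{11},b_{12},b_{21},b_{22},c\in\mathbb C$ be parameters (separate ones for each tetrahedron) with $\Delta=b_{11}b_{22}-b_{12}b_{21}\neq0$, and let $$\mathcal W_{ijkl}=\exp(ax_1x_2+b_{11}x_1y_1+b_{12}x_1y_2+b_{21}x_2y_1+b_{22}x_2y_2+cy_1y_2),$$ where the variables $(x_1,x_2;y_1,y_2)$ are: $(x_{124},x_{234};x_{123},x_{134})$ for $1234$; $(x_{134},x_{145};x_{135},x_{345})$ for $1345$; $(x_{124},x_{145};x_{125},x_{245})$ for $1245$; $(x_{234},x_{245};x_{235},x_{345})$ for $2345$; $(x_{125},x_{235};x_{123},x_{135})$ for $1235$. Let $$W_{ijkl}=\frac1\Delta\begin{pmatrix}cb_{21}&b_{11}(ac-\Delta)&-cb_{11}&b_{21}(ac-\Delta)\\-b_{22}&-ab_{12}&b_{12}&-ab_{22}\\cb_{22}&b_{12}(ac-\Delta)&-cb_{12}&b_{22}(ac-\Delta)\\b_{21}&ab_{11}&-b_{11}&ab_{21}\end{pmatrix}$$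 be the matrix of the canonical transformation associated with the operator $f\mapsto\int\mathcal W_{ijkl}f\,\mathrm dx_1\,\mathrm dx_2$. Regard these $4\times4$ matrices as $6\times6$ matrices acting in a direct sum of three two-dimensional spaces: $W_{1234}$ and $W_{1235}$ act in the first and second summands, $W_{1345}$ and $W_{2345}$ in the second and third, $W_{1245}$ in the first and third, each being the identity in the remaining summand. If $$W_{1345}W_{1234}=W_{1235}W_{2345}W_{1245},$$ then there is a nonzero constant $\mathrm{const}\in\mathbb C$ such that $$\int\mathcal W_{1234}\mathcal W_{1345}\,\mathrm dx_{134}=\mathrm{const}\iiint\mathcal W_{1245}\mathcal W_{2345}\mathcal W_{1235}\,\mathrm dx_{125}\,\mathrm dx_{235}\,\mathrm dx_{245}.$$ -/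

import Mathlib

/-- The ten two-dimensional faces `ijk` (`1 ≤ i < j < k ≤ 5`) of the tetrahedra taking part in the
Pachner move `2 → 3` on the vertices `1, …, 5`. -/
inductive Face : Type
  | f123 | f124 | f125 | f134 | f135 | f145 | f234 | f235 | f245 | f345
  deriving DecidableEq

instance : Fintype Face where
  elems := {.f123, .f124, .f125, .f134, .f135, .f145, .f234, .f235, .f245, .f345}
  complete := by intro t; cases t <;> decide

/-- The complex Grassmann algebra with one anticommuting generator for every face. -/
abbrev Grassmann : Type := ExteriorAlgebra ℂ (Face →₀ ℂ)

/-- The Grassmann generator attached to a face. -/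
noncomputable def gen (t : Face) : Grassmann :=
  ExteriorAlgebra.ι ℂ (Finsupp.single t 1)

/-- The Berezin integral `f ↦ ∫ f dx_t`, i.e. the right derivative with respect to the generator
`x_t`: right contraction with the `t`-th coordinate functional. -/
noncomputable def berezin (t : Face) : Grassmann →ₗ[ℂ] Grassmann :=
  (CliffordAlgebra.contractRight (Q := (0 : QuadraticForm ℂ (Face →₀ ℂ)))).flip
    (Finsupp.lapply t)

/-- `∫ dx_t = 0`. -/
theorem berezin_one (t : Face) : berezin t 1 = 0 := by
  simp [berezin]

/-- `∫ g x_s dx_t = g δ_{st} - (∫ g dx_t) x_s`. -/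
theorem berezin_mul_gen (t s : Face) (g : Grassmann) :
    berezin t (g * gen s) = (if s = t then g else 0) - berezin t g * gen s := by
  have h := CliffordAlgebra.contractRight_mul_ι (Q := (0 : QuadraticForm ℂ (Face →₀ ℂ)))
    (d := Finsupp.lapply t) (Finsupp.single s 1) g
  have h2 : berezin t (g * gen s)
      = (Finsupp.lapply t (Finsupp.single s (1 : ℂ)) : ℂ) • g - berezin t g * gen s := h
  rw [h2]
  congr 1
  by_cases hst : s = t <;> simp [hst]

/-- The six numeric parameters of a Grassmann–Gaussian exponent. -/
structure GaussParams where
  a : ℂ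
  b11 : ℂ
  b12 : ℂ
  b21 : ℂ
  b22 : ℂ
  c : ℂ

/-- `Δ = b₁₁ b₂₂ - b₁₂ b₂₁`. -/
def GaussParams.delta (p : GaussParams) : ℂ := p.b11 * p.b22 - p.b12 * p.b21

/-- The Gaussian exponent
`exp (a x₁ x₂ + b₁₁ x₁ y₁ + b₁₂ x₁ y₂ + b₂₁ x₂ y₁ + b₂₂ x₂ y₂ + c y₁ y₂)`. The argument of the
exponential is nilpotent, so that its Taylor series is the finite sum `IsNilpotent.exp`. -/
noncomputable def GaussParams.weight (p : GaussParams) (x₁ x₂ y₁ y₂ : Face) : Grassmann :=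
  IsNilpotent.exp
    (p.a • (gen x₁ * gen x₂)
      + p.b11 • (gen x₁ * gen y₁) + p.b12 • (gen x₁ * gen y₂)
      + p.b21 • (gen x₂ * gen y₁) + p.b22 • (gen x₂ * gen y₂)
      + p.c • (gen y₁ * gen y₂))

/-- The `4 × 4` matrix of the canonical transformation given by the operator
`f ↦ ∫ exp (a x₁ x₂ + … + c y₁ y₂) f dx₁ dx₂`, from the basis `∂/∂x₁, x₁, ∂/∂x₂, x₂` to the basis
`∂/∂y₁, y₁, ∂/∂y₂, y₂`. It is meaningful for `Δ ≠ 0`. -/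
noncomputable def GaussParams.mat (p : GaussParams) : Matrix (Fin 4) (Fin 4) ℂ :=
  (1 / p.delta) •
    !![p.c * p.b21, p.b11 * (p.a * p.c - p.delta), -p.c * p.b11, p.b21 * (p.a * p.c - p.delta);
       -p.b22, -p.a * p.b12, p.b12, -p.a * p.b22;
       p.c * p.b22, p.b12 * (p.a * p.c - p.delta), -p.c * p.b12, p.b22 * (p.a * p.c - p.delta);
       p.b21, p.a * p.b11, -p.b11, p.a * p.b21]

/-- A `4 × 4` matrix acting in the first and second of three two-dimensional summands, with the
identity in the third one. -/
def onSummands12 (M : Matrix (Fin 4) (Fin 4) ℂ) : Matrix (Fin 6) (Fin 6) ℂ :=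
  !![M 0 0, M 0 1, M 0 2, M 0 3, 0, 0;
     M 1 0, M 1 1, M 1 2, M 1 3, 0, 0;
     M 2 0, M 2 1, M 2 2, M 2 3, 0, 0;
     M 3 0, M 3 1, M 3 2, M 3 3, 0, 0;
     0, 0, 0, 0, 1, 0;
     0, 0, 0, 0, 0, 1]

/-- A `4 × 4` matrix acting in the first and third of three two-dimensional summands, with the
identity in the second one. -/
def onSummands13 (M : Matrix (Fin 4) (Fin 4) ℂ) : Matrix (Fin 6) (Fin 6) ℂ :=
  !![M 0 0, M 0 1, 0, 0, M 0 2, M 0 3;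
     M 1 0, M 1 1, 0, 0, M 1 2, M 1 3;
     0, 0, 1, 0, 0, 0;
     0, 0, 0, 1, 0, 0;
     M 2 0, M 2 1, 0, 0, M 2 2, M 2 3;
     M 3 0, M 3 1, 0, 0, M 3 2, M 3 3]

/-- A `4 × 4` matrix acting in the second and third of three two-dimensional summands, with the
identity in the first one. -/
def onSummands23 (M : Matrix (Fin 4) (Fin 4) ℂ) : Matrix (Fin 6) (Fin 6) ℂ :=
  !![1, 0, 0, 0, 0, 0;
     0, 1, 0, 0, 0, 0;
     0, 0, M 0 0, M 0 1, M 0 2, M 0 3;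
     0, 0, M 1 0, M 1 1, M 1 2, M 1 3;
     0, 0, M 2 0, M 2 1, M 2 2, M 2 3;
     0, 0, M 3 0, M 3 1, M 3 2, M 3 3]

/-- The pentagon relation in the direct sum: both sides take the bases in the triangles
`124, 234, 145` (in this order) to those in `123, 135, 345`. On the left the flips go through
`123, 134, 145`; on the right through `125, 234, 245` and then `125, 235, 345`. -/
def DirectSumPentagon (M1234 M1345 M1245 M2345 M1235 : Matrix (Fin 4) (Fin 4) ℂ) : Prop :=
  onSummands23 M1345 * onSummands12 M1234
    = onSummands12 M1235 * onSummands23 M2345 * onSummands13 M1245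

/-- The pentagon relation in the Grassmann algebra, with the numeric factor `k`. An iterated
integral `∫∫ f dx dy` is `∫ (∫ f dx) dy`. -/
def GrassmannPentagon (W1234 W1345 W1245 W2345 W1235 : Grassmann) (k : ℂ) : Prop :=
  berezin .f134 (W1234 * W1345)
    = k • berezin .f245 (berezin .f235 (berezin .f125 (W1245 * W2345 * W1235)))

/-! A Gaussian weight is governed by first-order linear equations: multiplication by and
differentiation in its `x` variables are expressed through those in its `y` variables, and the
coefficients are the columns of its canonical matrix (`GaussParams.transforms_weight`). The product
of the three weights on the right inherits these equations. Under the triple integral, integration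
by parts moves a derivative in an internal variable from one factor to the other, so the equations
chain and the integral `K` satisfies a six-dimensional system with the product matrix
(`tripleIntegral_transforms`).

The hypothesis replaces this matrix by the product of the other two. Factoring the system again, now
through the summand of `x₁₃₄`, turns it into equations on `K` that are also the equations of the
left side. The left side is `E v`, with `E` an invertible Gaussian and `v` a nonzero linear form
(`berezin_weight_mul_weight`), and the system has only multiples of `E v` as solutions
(`eq_smul_regularPart_mul_ι`). So `K = c E v`, and `c ≠ 0` because `K ≠ 0`
(`tripleIntegral_ne_zero`). -/

/-! ### Anticommutation and Berezin calculus -/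

theorem gen_mul_self (s : Face) : gen s * gen s = 0 :=
  ExteriorAlgebra.ι_sq_zero _

theorem gen_mul_gen (s t : Face) : gen s * gen t = -(gen t * gen s) :=
  eq_neg_of_add_eq_zero_left (ExteriorAlgebra.ι_add_mul_swap _ _)

theorem gen_mul_gen_assoc (s t : Face) (g : Grassmann) :
    gen s * (gen t * g) = -(gen t * (gen s * g)) := by
  rw [← mul_assoc, gen_mul_gen, neg_mul, mul_assoc]

theorem mul_gen_mul_gen (g : Grassmann) (s t : Face) :
    g * gen s * gen t = -(g * gen t * gen s) := by
  rw [mul_assoc, gen_mul_gen, mul_neg, mul_assoc]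

theorem berezin_ι (t : Face) (v : Face →₀ ℂ) :
    berezin t (ExteriorAlgebra.ι ℂ v) = v t • (1 : Grassmann) :=
  (CliffordAlgebra.contractRight_ι (Q := (0 : QuadraticForm ℂ (Face →₀ ℂ)))
    (d := Finsupp.lapply t) v).trans (Algebra.algebraMap_eq_smul_one _)

theorem berezin_gen (t s : Face) : berezin t (gen s) = if s = t then 1 else 0 := by
  have h := berezin_mul_gen t s 1
  simpa [berezin_one] using h

theorem berezin_self (t : Face) (g : Grassmann) : berezin t (berezin t g) = 0 :=
  CliffordAlgebra.contractRight_contractRight _ _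

theorem berezin_comm (s t : Face) (g : Grassmann) :
    berezin s (berezin t g) = -berezin t (berezin s g) :=
  CliffordAlgebra.contractRight_comm _ _ _

/-! ### Elements determined by their derivatives -/

/-- Successive multiplication by generators on the right. -/
noncomputable def mulGens (h : Grassmann) (l : List Face) : Grassmann :=
  l.foldr (fun t g => g * gen t) h

theorem mulGens_cons (h : Grassmann) (t : Face) (l : List Face) :
    mulGens h (t :: l) = mulGens h l * gen t := rfl

theorem mulGens_eq_mul (h : Grassmann) (l : List Face) : mulGens h l = h * mulGens 1 l := by
  induction l with
  | nil => simp [mulGens]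
  | cons s l ih => rw [mulGens_cons, mulGens_cons, ih, mul_assoc]

theorem berezin_mulGens {t : Face} {h : Grassmann} (hh : berezin t h = 0) {l : List Face}
    (hl : t ∉ l) : berezin t (mulGens h l) = 0 := by
  induction l with
  | nil => exact hh
  | cons s l ih =>
    rw [List.mem_cons, not_or] at hl
    rw [mulGens_cons, berezin_mul_gen, if_neg (Ne.symm hl.1), ih hl.2]
    simp

/-- Differentiating in the last generator of the product strips it off, since neither `h` nor the
remaining distinct generators involve it. -/
theorem eq_zero_of_mulGens_eq_zero {h : Grassmann} (hh : ∀ t, berezin t h = 0) {l : List Face}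
    (hl : l.Nodup) (h0 : mulGens h l = 0) : h = 0 := by
  induction l with
  | nil => exact h0
  | cons s l ih =>
    rw [List.nodup_cons] at hl
    refine ih hl.2 ?_
    have h1 := berezin_mul_gen s s (mulGens h l)
    rw [← mulGens_cons, h0, berezin_mulGens (hh s) hl.1] at h1
    simpa using h1.symm

theorem gen_mul_mulGens {t : Face} {l : List Face} (ht : t ∈ l) : gen t * mulGens 1 l = 0 := by
  have hcomm : ∀ l : List Face, ∃ e : ℂ, mulGens 1 l * gen t = e • (gen t * mulGens 1 l) := by
    intro l
    induction l with
    | nil => exact ⟨1, by simp [mulGens]⟩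
    | cons s l ih =>
      obtain ⟨e, he⟩ := ih
      refine ⟨-e, ?_⟩
      rw [mulGens_cons, mul_gen_mul_gen, he, smul_mul_assoc, neg_smul, mul_assoc]
  induction l with
  | nil => simp at ht
  | cons s l ih =>
    rw [mulGens_cons, ← mul_assoc]
    rcases List.mem_cons.1 ht with rfl | h
    · obtain ⟨e, he⟩ := hcomm l
      rw [mul_assoc, he, mul_smul_comm, ← mul_assoc, gen_mul_self, zero_mul, smul_zero]
    · rw [ih h, zero_mul]

theorem ι_eq_sum_gen (v : Face →₀ ℂ) : ExteriorAlgebra.ι ℂ v = ∑ t, v t • gen t := by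
  conv_lhs => rw [← Finsupp.univ_sum_single v]
  rw [map_sum]
  refine Finset.sum_congr rfl fun t _ => ?_
  rw [gen, ← map_smul, Finsupp.smul_single, smul_eq_mul, mul_one]

/-- A monomial containing all generators is killed by each of them, so the algebra acts on its line
through the constant term. -/
theorem exists_mul_mulGens {l : List Face} (hl : ∀ t, t ∈ l) (g : Grassmann) :
    ∃ c : ℂ, g * mulGens 1 l = c • mulGens 1 l := by
  induction g using ExteriorAlgebra.induction with
  | algebraMap r => exact ⟨r, by rw [Algebra.smul_def]⟩
  | ι v =>
    refine ⟨0, ?_⟩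
    rw [ι_eq_sum_gen, Finset.sum_mul, zero_smul]
    exact Finset.sum_eq_zero fun t _ => by rw [smul_mul_assoc, gen_mul_mulGens (hl t), smul_zero]
  | mul a b ha hb =>
    obtain ⟨c, hc⟩ := ha
    obtain ⟨d, hd⟩ := hb
    exact ⟨d * c, by rw [mul_assoc, hd, mul_smul_comm, hc, smul_smul]⟩
  | add a b ha hb =>
    obtain ⟨c, hc⟩ := ha
    obtain ⟨d, hd⟩ := hb
    exact ⟨c + d, by rw [add_mul, hc, hd, add_smul]⟩

/-- An element all of whose Berezin integrals vanish is a scalar. -/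
theorem exists_eq_smul_one {g : Grassmann} (hg : ∀ t, berezin t g = 0) :
    ∃ c : ℂ, g = c • (1 : Grassmann) := by
  have hl : ∀ t, t ∈ (Finset.univ : Finset Face).toList := fun t => by simp
  -- The top monomial detects the constant term `c`; then `g - c` has zero derivatives and kills
  -- that monomial.
  obtain ⟨c, hc⟩ := exists_mul_mulGens hl g
  refine ⟨c, sub_eq_zero.1 (eq_zero_of_mulGens_eq_zero (fun t => ?_)
    (Finset.nodup_toList Finset.univ) ?_)⟩
  · rw [map_sub, map_smul, berezin_one, hg t, smul_zero, sub_zero]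
  · rw [mulGens_eq_mul, sub_mul, hc, smul_mul_assoc, one_mul, sub_self]

/-- The equations satisfied by a multiple of a nonzero linear form determine it. -/
theorem exists_eq_smul_ι {K s : Grassmann} {v : Face →₀ ℂ} (hv : v ≠ 0)
    (hKv : K * ExteriorAlgebra.ι ℂ v = 0) (hK : ∀ t, berezin t K = -(v t • s)) :
    ∃ c : ℂ, K = c • ExteriorAlgebra.ι ℂ v := by
  obtain ⟨t₀, ht₀⟩ := Finsupp.ne_iff.1 hv
  -- Compatibility of the system: second derivatives of `K` anticommute. Taking both indices equal
  -- to `t₀` gives `∂s = 0` there, then everywhere.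
  have hcomm : ∀ t u, v u • berezin t s = -(v t • berezin u s) := by
    intro t u
    have h := berezin_comm t u K
    rw [hK, hK, map_neg, map_neg, map_smul, map_smul, neg_neg] at h
    rw [← h, neg_neg]
  have h0 : berezin t₀ s = 0 := by
    have h : (2 : ℂ) • (v t₀ • berezin t₀ s) = 0 := by
      rw [two_smul]
      nth_rewrite 1 [hcomm t₀ t₀]
      exact neg_add_cancel _
    exact (smul_eq_zero.1 ((smul_eq_zero.1 h).resolve_left two_ne_zero)).resolve_left ht₀
  have hs : ∀ t, berezin t s = 0 := by
    intro t
    have h := hcomm t t₀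
    rw [h0, smul_zero, neg_zero] at h
    exact (smul_eq_zero.1 h).resolve_left ht₀
  obtain ⟨σ, rfl⟩ := exists_eq_smul_one hs
  -- With `s = σ` a scalar, `K + σ v` has zero derivatives, so it is a scalar `τ`; multiplying by
  -- `v` forces `τ = 0`.
  obtain ⟨τ, hτ⟩ := exists_eq_smul_one (g := K + σ • ExteriorAlgebra.ι ℂ v) (fun t => by
    rw [map_add, map_smul, hK, berezin_ι, smul_comm, neg_add_cancel])
  have h1 : τ • ExteriorAlgebra.ι ℂ v = 0 := by
    have h := congrArg (· * ExteriorAlgebra.ι ℂ v) hτ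
    simp only [add_mul, hKv, smul_mul_assoc, ExteriorAlgebra.ι_sq_zero, one_mul, smul_zero,
      add_zero] at h
    exact h.symm
  have h2 : τ = 0 := by
    have h := congrArg (berezin t₀) h1
    rw [map_smul, berezin_ι, map_zero, smul_smul] at h
    rcases smul_eq_zero.1 h with h | h
    · exact (mul_eq_zero.1 h).resolve_right ht₀
    · exact absurd h one_ne_zero
  refine ⟨-σ, ?_⟩
  rw [h2, zero_smul] at hτ
  rw [neg_smul]
  exact eq_neg_of_add_eq_zero_left hτ

/-! ### Even elements and Gaussian weights -/

/-- Even elements: they are central and the Leibniz rule holds for them without a sign. -/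
structure IsGrassmannEven (w : Grassmann) : Prop where
  comm : ∀ g, w * g = g * w
  leibniz : ∀ t g, berezin t (g * w) = berezin t g * w + g * berezin t w

theorem IsGrassmannEven.mul {w w' : Grassmann} (h : IsGrassmannEven w) (h' : IsGrassmannEven w') :
    IsGrassmannEven (w * w') where
  comm g := by rw [mul_assoc, h'.comm, ← mul_assoc, h.comm, mul_assoc]
  leibniz t g := by
    rw [← mul_assoc, h'.leibniz, h.leibniz, h'.leibniz]
    noncomm_ring

/-- The Grassmann exponential `exp (c x y)` for two generators `x, y`. -/
noncomputable def pairExp (c : ℂ) (x y : Face) : Grassmann := 1 + c • (gen x * gen y)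

/-- The right derivative of `c x y`. -/
noncomputable def pairForce (t : Face) (c : ℂ) (x y : Face) : Grassmann :=
  c • ((if y = t then gen x else 0) - (if x = t then gen y else 0))

theorem gen_mul_gen_comm (x y : Face) (g : Grassmann) :
    gen x * gen y * g = g * (gen x * gen y) := by
  induction g using ExteriorAlgebra.induction with
  | algebraMap r => exact (Algebra.commutes r _).symm
  | ι v =>
    have hxy : ∀ t, gen x * gen y * gen t = gen t * (gen x * gen y) := fun t => by
      rw [mul_assoc, gen_mul_gen y t, mul_neg, gen_mul_gen_assoc, neg_neg]
    rw [ι_eq_sum_gen, Finset.sum_mul, Finset.mul_sum]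
    exact Finset.sum_congr rfl fun t _ => by rw [mul_smul_comm, smul_mul_assoc, hxy]
  | mul a b ha hb => rw [← mul_assoc, ha, mul_assoc, hb, mul_assoc]
  | add a b ha hb => rw [mul_add, add_mul, ha, hb]

theorem berezin_mul_gen_mul_gen (t x y : Face) (g : Grassmann) :
    berezin t (g * (gen x * gen y)) = berezin t g * (gen x * gen y) + g * pairForce t 1 x y := by
  rw [← mul_assoc, berezin_mul_gen, berezin_mul_gen, pairForce, one_smul]
  split_ifs <;> noncomm_ring

theorem berezin_pairExp_eq_pairForce (t : Face) (c : ℂ) (x y : Face) :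
    berezin t (pairExp c x y) = pairForce t c x y := by
  have h := berezin_mul_gen_mul_gen t x y 1
  rw [one_mul, one_mul, berezin_one, zero_mul, zero_add] at h
  rw [pairExp, map_add, berezin_one, zero_add, map_smul, h]
  simp only [pairForce, one_smul]

theorem isGrassmannEven_pairExp (c : ℂ) (x y : Face) : IsGrassmannEven (pairExp c x y) where
  comm g := by
    rw [pairExp, add_mul, mul_add, smul_mul_assoc, mul_smul_comm, gen_mul_gen_comm, one_mul,
      mul_one]
  leibniz t g := by
    rw [berezin_pairExp_eq_pairForce, pairExp, mul_add, mul_add, mul_one, mul_one, map_add, mul_smul_comm,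
      map_smul, berezin_mul_gen_mul_gen, mul_smul_comm, smul_add, ← mul_smul_comm c g]
    simp only [pairForce, one_smul, add_assoc]

/-- The logarithmic derivative of an exponential is the derivative of its exponent; the quadratic
correction contains a repeated generator. -/
theorem berezin_pairExp (t : Face) (c : ℂ) (x y : Face) :
    berezin t (pairExp c x y) = pairExp c x y * pairForce t c x y := by
  have h : gen x * gen y * pairForce t c x y = 0 := by
    have hy : gen x * gen y * gen y = 0 := by rw [mul_assoc, gen_mul_self, mul_zero]
    have hx : gen x * gen y * gen x = 0 := by
      rw [gen_mul_gen, neg_mul, mul_assoc, gen_mul_self, mul_zero, neg_zero]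
    rw [pairForce]
    split_ifs <;> simp [mul_sub, hx, hy]
  rw [berezin_pairExp_eq_pairForce, pairExp, add_mul, one_mul, smul_mul_assoc, h, smul_zero, add_zero]

theorem sq_smul_gen_mul_gen (c : ℂ) (x y : Face) : (c • (gen x * gen y)) ^ 2 = 0 := by
  have h : gen x * gen y * gen x = 0 := by
    rw [gen_mul_gen, neg_mul, mul_assoc, gen_mul_self, mul_zero, neg_zero]
  rw [pow_two, smul_mul_smul_comm, ← mul_assoc, h, zero_mul, smul_zero]

theorem exp_smul_gen_mul_gen (c : ℂ) (x y : Face) :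
    IsNilpotent.exp (c • (gen x * gen y)) = pairExp c x y := by
  rw [IsNilpotent.exp_eq_sum (sq_smul_gen_mul_gen c x y)]
  simp [Finset.sum_range_succ, pairExp]

theorem isUnit_pairExp (c : ℂ) (x y : Face) : IsUnit (pairExp c x y) := by
  rw [← exp_smul_gen_mul_gen]
  exact IsNilpotent.isUnit_exp ⟨2, sq_smul_gen_mul_gen c x y⟩

theorem IsGrassmannEven.berezin_mul {w w' : Grassmann} (h' : IsGrassmannEven w') {t : Face}
    {f f' : Grassmann} (hw : berezin t w = w * f) (hw' : berezin t w' = w' * f') :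
    berezin t (w * w') = w * w' * (f + f') := by
  rw [h'.leibniz, hw, hw', mul_assoc, ← h'.comm f]
  noncomm_ring

/-- The six terms are central with square zero, so the exponential splits. Evenness, invertibility
and derivatives can then be treated factor by factor. -/
theorem weight_eq (p : GaussParams) (x₁ x₂ y₁ y₂ : Face) :
    p.weight x₁ x₂ y₁ y₂ = pairExp p.a x₁ x₂ * pairExp p.b11 x₁ y₁ * pairExp p.b12 x₁ y₂
      * pairExp p.b21 x₂ y₁ * pairExp p.b22 x₂ y₂ * pairExp p.c y₁ y₂ := by
  have hn : ∀ (c : ℂ) (x y : Face), IsNilpotent (c • (gen x * gen y)) :=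
    fun c x y => ⟨2, sq_smul_gen_mul_gen c x y⟩
  have hc : ∀ (g : Grassmann) (c : ℂ) (x y : Face), Commute g (c • (gen x * gen y)) :=
    fun g c x y => by
      rw [Commute, SemiconjBy, mul_smul_comm, smul_mul_assoc, gen_mul_gen_comm]
  have ha : ∀ (g : Grassmann) (c : ℂ) (x y : Face), IsNilpotent g →
      IsNilpotent (g + c • (gen x * gen y)) :=
    fun g c x y hg => (hc g c x y).isNilpotent_add hg (hn c x y)
  have h1 := hn p.a x₁ x₂
  have h2 := ha _ p.b11 x₁ y₁ h1
  have h3 := ha _ p.b12 x₁ y₂ h2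
  have h4 := ha _ p.b21 x₂ y₁ h3
  have h5 := ha _ p.b22 x₂ y₂ h4
  rw [GaussParams.weight, IsNilpotent.exp_add_of_commute (hc _ _ _ _) h5 (hn _ _ _),
    IsNilpotent.exp_add_of_commute (hc _ _ _ _) h4 (hn _ _ _),
    IsNilpotent.exp_add_of_commute (hc _ _ _ _) h3 (hn _ _ _),
    IsNilpotent.exp_add_of_commute (hc _ _ _ _) h2 (hn _ _ _),
    IsNilpotent.exp_add_of_commute (hc _ _ _ _) h1 (hn _ _ _)]
  simp only [exp_smul_gen_mul_gen]

theorem isGrassmannEven_weight (p : GaussParams) (x₁ x₂ y₁ y₂ : Face) :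
    IsGrassmannEven (p.weight x₁ x₂ y₁ y₂) := by
  rw [weight_eq]
  exact (((((isGrassmannEven_pairExp _ _ _).mul (isGrassmannEven_pairExp _ _ _)).mul
    (isGrassmannEven_pairExp _ _ _)).mul (isGrassmannEven_pairExp _ _ _)).mul
    (isGrassmannEven_pairExp _ _ _)).mul (isGrassmannEven_pairExp _ _ _)

theorem isUnit_weight (p : GaussParams) (x₁ x₂ y₁ y₂ : Face) :
    IsUnit (p.weight x₁ x₂ y₁ y₂) := by
  rw [weight_eq]
  exact (((((isUnit_pairExp _ _ _).mul (isUnit_pairExp _ _ _)).mul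
    (isUnit_pairExp _ _ _)).mul (isUnit_pairExp _ _ _)).mul
    (isUnit_pairExp _ _ _)).mul (isUnit_pairExp _ _ _)

theorem berezin_weight (t : Face) (p : GaussParams) (x₁ x₂ y₁ y₂ : Face) :
    berezin t (p.weight x₁ x₂ y₁ y₂) = p.weight x₁ x₂ y₁ y₂ *
      (pairForce t p.a x₁ x₂ + pairForce t p.b11 x₁ y₁ + pairForce t p.b12 x₁ y₂
        + pairForce t p.b21 x₂ y₁ + pairForce t p.b22 x₂ y₂ + pairForce t p.c y₁ y₂) := by
  rw [weight_eq]
  have h := berezin_pairExp t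
  have e := isGrassmannEven_pairExp
  exact (e _ _ _).berezin_mul ((e _ _ _).berezin_mul ((e _ _ _).berezin_mul
    ((e _ _ _).berezin_mul ((e _ _ _).berezin_mul (h _ _ _) (h _ _ _)) (h _ _ _))
    (h _ _ _)) (h _ _ _)) (h _ _ _)

/-! ### Weights as canonical transformations -/

/-- The vectors `(X₁, DX₁, X₂, DX₂)` are obtained from `(Y₁, EY₁, Y₂, EY₂)` with the columns of the
matrix of the canonical transformation. -/
def GaussParams.Transforms (p : GaussParams) (X Y : Fin 4 → Grassmann) : Prop :=
  ∀ j, X j = ∑ i, p.mat i j • Y i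

/-- Solving the column equations for the derivatives instead of for the `X` and `DX` clears the
denominator `Δ` and leaves the gradient of the quadratic exponent. -/
theorem GaussParams.transforms_iff {p : GaussParams} (hp : p.delta ≠ 0)
    (X₁ DX₁ X₂ DX₂ Y₁ EY₁ Y₂ EY₂ : Grassmann) :
    p.Transforms ![X₁, DX₁, X₂, DX₂] ![Y₁, EY₁, Y₂, EY₂] ↔
      DX₁ = -(p.a • X₂ + p.b11 • Y₁ + p.b12 • Y₂) ∧
      DX₂ = p.a • X₁ - p.b21 • Y₁ - p.b22 • Y₂ ∧
      EY₁ = p.c • Y₂ - p.b11 • X₁ - p.b21 • X₂ ∧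
      EY₂ = -(p.c • Y₁ + p.b12 • X₁ + p.b22 • X₂) := by
  have hd : p.b11 * p.b22 - p.b12 * p.b21 ≠ 0 := hp
  have hd₁ : p.b11 * p.b22 - p.b21 * p.b12 ≠ 0 := by rwa [mul_comm p.b21]
  have hd₂ : p.b22 * p.b11 - p.b12 * p.b21 ≠ 0 := by rwa [mul_comm p.b22]
  simp only [GaussParams.Transforms, Fin.forall_fin_succ, IsEmpty.forall_iff, and_true,
    Fin.sum_univ_four, GaussParams.mat, GaussParams.delta]
  simp only [Matrix.smul_apply, Matrix.of_apply, Matrix.cons_val, smul_eq_mul,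
    Fin.succ_zero_eq_one, Fin.succ_one_eq_two, Fin.isValue]
  constructor
  · rintro ⟨h1, h2, h3, h4⟩
    simp at h1 h2 h3 h4
    subst h1 h2 h3 h4
    refine ⟨?_, ?_, ?_, ?_⟩ <;> match_scalars <;> field_simp <;> ring
  · rintro ⟨h1, h2, h3, h4⟩
    subst h1 h2 h3 h4
    refine ⟨?_, ?_, ?_, ?_⟩ <;> simp <;> match_scalars <;> field_simp <;> ring

theorem GaussParams.transforms_weight {p : GaussParams} (hp : p.delta ≠ 0) {x₁ x₂ y₁ y₂ : Face}
    (hd : [x₁, x₂, y₁, y₂].Nodup) :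
    p.Transforms
      ![p.weight x₁ x₂ y₁ y₂ * gen x₁, berezin x₁ (p.weight x₁ x₂ y₁ y₂),
        p.weight x₁ x₂ y₁ y₂ * gen x₂, berezin x₂ (p.weight x₁ x₂ y₁ y₂)]
      ![p.weight x₁ x₂ y₁ y₂ * gen y₁, -berezin y₁ (p.weight x₁ x₂ y₁ y₂),
        p.weight x₁ x₂ y₁ y₂ * gen y₂, -berezin y₂ (p.weight x₁ x₂ y₁ y₂)] := by
  simp only [List.nodup_cons, List.mem_cons, not_or, List.not_mem_nil, not_false_iff,
    List.nodup_nil, and_true] at hd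
  obtain ⟨⟨h1, h2, h3⟩, ⟨h4, h5⟩, h6⟩ := hd
  rw [GaussParams.transforms_iff hp]
  simp only [berezin_weight, pairForce, h1, h2, h3, h4, h5, h6, Ne.symm h1, Ne.symm h2, Ne.symm h3,
    Ne.symm h4, Ne.symm h5, Ne.symm h6, if_true, if_false, ← mul_smul_comm, ← mul_add, ← mul_sub,
    ← mul_neg]
  refine ⟨?_, ?_, ?_, ?_⟩ <;> congr 1 <;> module

theorem GaussParams.Transforms.map {p : GaussParams} {X Y : Fin 4 → Grassmann}
    (h : p.Transforms X Y) (f : Grassmann →ₗ[ℂ] Grassmann) :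
    p.Transforms (f ∘ X) (f ∘ Y) := fun j => by
  simp only [Function.comp_apply, h j, map_sum, map_smul]

/-- Vectors are expressed by columns, so successive substitutions multiply matrices from right to
left. -/
theorem sum_smul_trans {n : ℕ} {A B : Matrix (Fin n) (Fin n) ℂ} {z s o : Fin n → Grassmann}
    (hz : ∀ j, z j = ∑ i, A i j • s i) (hs : ∀ j, s j = ∑ i, B i j • o i) (j : Fin n) :
    z j = ∑ i, (B * A) i j • o i := by
  simp only [hz, hs, Finset.smul_sum, Matrix.mul_apply, Finset.sum_smul, smul_smul]
  rw [Finset.sum_comm]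
  simp only [mul_comm]

theorem onSummands12_iff {p : GaussParams} (z s : Fin 6 → Grassmann) :
    (∀ j, z j = ∑ i, onSummands12 p.mat i j • s i) ↔
      p.Transforms ![z 0, z 1, z 2, z 3] ![s 0, s 1, s 2, s 3] ∧ z 4 = s 4 ∧ z 5 = s 5 := by
  simp [GaussParams.Transforms, Fin.forall_fin_succ, Fin.sum_univ_succ, onSummands12, and_assoc]

theorem onSummands13_iff {p : GaussParams} (z s : Fin 6 → Grassmann) :
    (∀ j, z j = ∑ i, onSummands13 p.mat i j • s i) ↔
      p.Transforms ![z 0, z 1, z 4, z 5] ![s 0, s 1, s 4, s 5] ∧ z 2 = s 2 ∧ z 3 = s 3 := by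
  simp [GaussParams.Transforms, Fin.forall_fin_succ, Fin.sum_univ_succ, onSummands13]
  tauto

theorem onSummands23_iff {p : GaussParams} (z s : Fin 6 → Grassmann) :
    (∀ j, z j = ∑ i, onSummands23 p.mat i j • s i) ↔
      p.Transforms ![z 2, z 3, z 4, z 5] ![s 2, s 3, s 4, s 5] ∧ z 0 = s 0 ∧ z 1 = s 1 := by
  simp [GaussParams.Transforms, Fin.forall_fin_succ, Fin.sum_univ_succ, onSummands23]
  tauto

theorem GaussParams.Transforms.map_cons {p : GaussParams}
    {X₁ DX₁ X₂ DX₂ Y₁ EY₁ Y₂ EY₂ : Grassmann}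
    (h : p.Transforms ![X₁, DX₁, X₂, DX₂] ![Y₁, EY₁, Y₂, EY₂]) (f : Grassmann →ₗ[ℂ] Grassmann) :
    p.Transforms ![f X₁, f DX₁, f X₂, f DX₂] ![f Y₁, f EY₁, f Y₂, f EY₂] := fun j => by
  have hj := h.map f j
  fin_cases j <;> simpa [Fin.sum_univ_four] using hj

/-- A factorization of the matrix supplies an intermediate vector, which need not come from actual
products and derivatives. -/
theorem exists_sum_smul_of_mul {n : ℕ} {A B : Matrix (Fin n) (Fin n) ℂ}
    {z o : Fin n → Grassmann} (h : ∀ j, z j = ∑ i, (B * A) i j • o i) :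
    ∃ s : Fin n → Grassmann, (∀ j, z j = ∑ i, A i j • s i) ∧ ∀ j, s j = ∑ i, B i j • o i := by
  refine ⟨fun j => ∑ i, B i j • o i, fun j => ?_, fun _ => rfl⟩
  rw [h j]
  exact (sum_smul_trans (fun _ => rfl) (fun _ => rfl) j).symm

theorem berezin_weight_of_notMem {t : Face} (p : GaussParams) {x₁ x₂ y₁ y₂ : Face}
    (ht : t ∉ [x₁, x₂, y₁, y₂]) : berezin t (p.weight x₁ x₂ y₁ y₂) = 0 := by
  simp only [List.mem_cons, List.not_mem_nil, or_false, not_or] at ht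
  obtain ⟨h1, h2, h3, h4⟩ := ht
  rw [berezin_weight]
  simp [pairForce, Ne.symm h1, Ne.symm h2, Ne.symm h3, Ne.symm h4]

theorem IsGrassmannEven.mul_gen_mul {w : Grassmann} (h : IsGrassmannEven w) (g : Grassmann)
    (s : Face) : g * gen s * w = g * w * gen s := by
  rw [mul_assoc, ← h.comm, mul_assoc]

theorem berezin_mul_gen_of_ne {t s : Face} (h : s ≠ t) (g : Grassmann) :
    berezin t (g * gen s) = -(berezin t g * gen s) := by
  rw [berezin_mul_gen, if_neg h, zero_sub]

/-! ### The triple integral and its linear equations -/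

/-- The iterated integral `∫∫∫ · dx₁₂₅ dx₂₃₅ dx₂₄₅`. -/
noncomputable def tripleIntegral : Grassmann →ₗ[ℂ] Grassmann :=
  berezin .f245 ∘ₗ berezin .f235 ∘ₗ berezin .f125

theorem tripleIntegral_apply (g : Grassmann) :
    tripleIntegral g = berezin .f245 (berezin .f235 (berezin .f125 g)) := rfl

theorem tripleIntegral_mul_gen {s : Face} (hs : s ∉ [Face.f125, .f235, .f245]) (g : Grassmann) :
    tripleIntegral (g * gen s) = -(tripleIntegral g * gen s) := by
  simp only [List.mem_cons, List.not_mem_nil, or_false, not_or] at hs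
  obtain ⟨h1, h2, h3⟩ := hs
  simp only [tripleIntegral_apply, berezin_mul_gen_of_ne h1, berezin_mul_gen_of_ne h2,
    berezin_mul_gen_of_ne h3, map_neg, neg_neg]

/-- Three transpositions give the sign `-1`, the same as for multiplication by an external
generator; the linear relations are insensitive to it. -/
theorem tripleIntegral_berezin (s : Face) (g : Grassmann) :
    tripleIntegral (berezin s g) = -berezin s (tripleIntegral g) := by
  simp only [tripleIntegral_apply]
  rw [berezin_comm _ s, map_neg, berezin_comm _ s, map_neg, map_neg, berezin_comm _ s, neg_neg]

theorem berezin_tripleIntegral {t : Face} (ht : t ∈ [Face.f125, .f235, .f245]) (g : Grassmann) :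
    berezin t (tripleIntegral g) = 0 := by
  simp only [List.mem_cons, List.not_mem_nil, or_false] at ht
  simp only [tripleIntegral_apply]
  rcases ht with rfl | rfl | rfl
  · rw [berezin_comm, berezin_comm .f125, berezin_self]
    simp
  · rw [berezin_comm, berezin_self, map_zero, neg_zero]
  · rw [berezin_self]

/-- Integration by parts: the integral of a derivative in an integrated variable vanishes. -/
theorem tripleIntegral_berezin_internal {t : Face} (ht : t ∈ [Face.f125, .f235, .f245])
    (g : Grassmann) : tripleIntegral (berezin t g) = 0 := by
  rw [tripleIntegral_berezin, berezin_tripleIntegral ht, neg_zero]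

theorem IsGrassmannEven.berezin_mul_mul {A B C : Grassmann} (hB : IsGrassmannEven B)
    (hC : IsGrassmannEven C) (t : Face) :
    berezin t (A * B * C) = berezin t A * B * C + A * berezin t B * C + A * B * berezin t C := by
  rw [hC.leibniz, hB.leibniz, add_mul]

theorem transforms_chain {pA pB pC : GaussParams}
    {z₀ z₁ z₂ z₃ z₄ z₅ a₀ a₁ a₄ a₅ b₂ b₃ o₀ o₁ o₂ o₃ o₄ o₅ : Grassmann}
    (hA : pA.Transforms ![z₀, z₁, z₄, z₅] ![a₀, a₁, a₄, a₅])
    (hB : pB.Transforms ![z₂, z₃, a₄, a₅] ![b₂, b₃, o₄, o₅])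
    (hC : pC.Transforms ![a₀, a₁, b₂, b₃] ![o₀, o₁, o₂, o₃]) (j : Fin 6) :
    (![z₀, z₁, z₂, z₃, z₄, z₅] : Fin 6 → Grassmann) j
      = ∑ i, (onSummands12 pC.mat * onSummands23 pB.mat * onSummands13 pA.mat) i j •
        (![o₀, o₁, o₂, o₃, o₄, o₅] : Fin 6 → Grassmann) i := by
  have h1 := (onSummands13_iff (p := pA) ![z₀, z₁, z₂, z₃, z₄, z₅] ![a₀, a₁, z₂, z₃, a₄, a₅]).2
    ⟨hA, rfl, rfl⟩
  have h2 := (onSummands23_iff (p := pB) ![a₀, a₁, z₂, z₃, a₄, a₅] ![a₀, a₁, b₂, b₃, o₄, o₅]).2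
    ⟨hB, rfl, rfl⟩
  have h3 := (onSummands12_iff (p := pC) ![a₀, a₁, b₂, b₃, o₄, o₅] ![o₀, o₁, o₂, o₃, o₄, o₅]).2
    ⟨hC, rfl, rfl⟩
  exact sum_smul_trans h1 (sum_smul_trans h2 h3) j

set_option maxHeartbeats 1000000 in
/-- The canonical transformation given by the right-hand side of the pentagon relation. -/
theorem tripleIntegral_transforms (p1245 p2345 p1235 : GaussParams)
    (h1245 : p1245.delta ≠ 0) (h2345 : p2345.delta ≠ 0) (h1235 : p1235.delta ≠ 0)
    {H : Grassmann}
    (hH : H = p1245.weight .f124 .f145 .f125 .f245 * p2345.weight .f234 .f245 .f235 .f345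
      * p1235.weight .f125 .f235 .f123 .f135) (j : Fin 6) :
    (![tripleIntegral (H * gen .f124), tripleIntegral (berezin .f124 H),
       tripleIntegral (H * gen .f234), tripleIntegral (berezin .f234 H),
       tripleIntegral (H * gen .f145), tripleIntegral (berezin .f145 H)] : Fin 6 → Grassmann) j
    = ∑ i, (onSummands12 p1235.mat * onSummands23 p2345.mat * onSummands13 p1245.mat) i j •
      (![tripleIntegral (H * gen .f123), -tripleIntegral (berezin .f123 H),
         tripleIntegral (H * gen .f135), -tripleIntegral (berezin .f135 H),
         tripleIntegral (H * gen .f345), -tripleIntegral (berezin .f345 H)]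
        : Fin 6 → Grassmann) i := by
  have tA := GaussParams.transforms_weight h1245 (x₁ := .f124) (x₂ := .f145) (y₁ := .f125)
    (y₂ := .f245) (by decide)
  have tB := GaussParams.transforms_weight h2345 (x₁ := .f234) (x₂ := .f245) (y₁ := .f235)
    (y₂ := .f345) (by decide)
  have tC := GaussParams.transforms_weight h1235 (x₁ := .f125) (x₂ := .f235) (y₁ := .f123)
    (y₂ := .f135) (by decide)
  have eB := isGrassmannEven_weight p2345 .f234 .f245 .f235 .f345
  have eC := isGrassmannEven_weight p1235 .f125 .f235 .f123 .f135
  have zA : ∀ t ∉ [Face.f124, .f145, .f125, .f245],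
    berezin t (p1245.weight .f124 .f145 .f125 .f245) = 0 := fun t => berezin_weight_of_notMem _
  have zB : ∀ t ∉ [Face.f234, .f245, .f235, .f345],
    berezin t (p2345.weight .f234 .f245 .f235 .f345) = 0 := fun t => berezin_weight_of_notMem _
  have zC : ∀ t ∉ [Face.f125, .f235, .f123, .f135],
    berezin t (p1235.weight .f125 .f235 .f123 .f135) = 0 := fun t => berezin_weight_of_notMem _
  generalize p1245.weight .f124 .f145 .f125 .f245 = A at *
  generalize p2345.weight .f234 .f245 .f235 .f345 = B at *
  generalize p1235.weight .f125 .f235 .f123 .f135 = C at *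
  subst hH
  have dH := fun t => eB.berezin_mul_mul (A := A) eC t
  have i125 := tripleIntegral_berezin_internal (t := .f125) (by decide) (A * B * C)
  have i235 := tripleIntegral_berezin_internal (t := .f235) (by decide) (A * B * C)
  have i245 := tripleIntegral_berezin_internal (t := .f245) (by decide) (A * B * C)
  -- Each internal variable occurs in exactly two factors, so its vanishing integral equates one
  -- derivative with minus the other. This matches the sign of `-∂/∂y` in one factor to `∂/∂x` in
  -- the next.
  rw [dH, zB _ (by decide), mul_zero, zero_mul, add_zero, map_add] at i125
  rw [dH, zA _ (by decide), zero_mul, zero_mul, zero_add, map_add] at i235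
  rw [dH, zC _ (by decide), mul_zero, add_zero, map_add] at i245
  have d124 : berezin .f124 (A * B * C) = berezin .f124 A * B * C := by
    simp [dH, zB .f124 (by decide), zC .f124 (by decide)]
  have d145 : berezin .f145 (A * B * C) = berezin .f145 A * B * C := by
    simp [dH, zB .f145 (by decide), zC .f145 (by decide)]
  have d234 : berezin .f234 (A * B * C) = A * berezin .f234 B * C := by
    simp [dH, zA .f234 (by decide), zC .f234 (by decide)]
  have d345 : berezin .f345 (A * B * C) = A * berezin .f345 B * C := by
    simp [dH, zA .f345 (by decide), zC .f345 (by decide)]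
  have d123 : berezin .f123 (A * B * C) = A * B * berezin .f123 C := by
    simp [dH, zA .f123 (by decide), zB .f123 (by decide)]
  have d135 : berezin .f135 (A * B * C) = A * B * berezin .f135 C := by
    simp [dH, zA .f135 (by decide), zB .f135 (by decide)]
  have sA : p1245.Transforms
      ![tripleIntegral (A * B * C * gen .f124), tripleIntegral (berezin .f124 (A * B * C)),
        tripleIntegral (A * B * C * gen .f145), tripleIntegral (berezin .f145 (A * B * C))]
      ![tripleIntegral (A * B * C * gen .f125), tripleIntegral (A * B * berezin .f125 C),
        tripleIntegral (A * B * C * gen .f245), tripleIntegral (A * berezin .f245 B * C)] := by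
    have h := tA.map_cons
      (tripleIntegral ∘ₗ LinearMap.mulRight ℂ C ∘ₗ LinearMap.mulRight ℂ B)
    simp only [LinearMap.comp_apply, LinearMap.mulRight_apply, eB.mul_gen_mul, eC.mul_gen_mul,
      map_neg] at h
    rwa [neg_eq_of_add_eq_zero_right i125, neg_eq_of_add_eq_zero_right i245, ← d124, ← d145] at h
  have sB : p2345.Transforms
      ![tripleIntegral (A * B * C * gen .f234), tripleIntegral (berezin .f234 (A * B * C)),
        tripleIntegral (A * B * C * gen .f245), tripleIntegral (A * berezin .f245 B * C)]
      ![tripleIntegral (A * B * C * gen .f235), tripleIntegral (A * B * berezin .f235 C),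
        tripleIntegral (A * B * C * gen .f345),
        -tripleIntegral (berezin .f345 (A * B * C))] := by
    have h := tB.map_cons
      (tripleIntegral ∘ₗ LinearMap.mulRight ℂ C ∘ₗ LinearMap.mulLeft ℂ A)
    simp only [LinearMap.comp_apply, LinearMap.mulRight_apply, LinearMap.mulLeft_apply,
      ← mul_assoc, eC.mul_gen_mul, map_neg] at h
    rwa [neg_eq_of_add_eq_zero_right i235, ← d234, ← d345] at h
  have sC : p1235.Transforms
      ![tripleIntegral (A * B * C * gen .f125), tripleIntegral (A * B * berezin .f125 C),
        tripleIntegral (A * B * C * gen .f235), tripleIntegral (A * B * berezin .f235 C)]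
      ![tripleIntegral (A * B * C * gen .f123), -tripleIntegral (berezin .f123 (A * B * C)),
        tripleIntegral (A * B * C * gen .f135),
        -tripleIntegral (berezin .f135 (A * B * C))] := by
    have h := tC.map_cons (tripleIntegral ∘ₗ LinearMap.mulLeft ℂ (A * B))
    simp only [LinearMap.comp_apply, LinearMap.mulLeft_apply,
      ← mul_assoc, map_neg] at h
    rwa [← d123, ← d135] at h
  exact transforms_chain sA sB sC j

/-! ### Nonvanishing of the triple integral -/

/-- When all integrated generators are already present, integration only removes them, and
multiplying them back recovers the integrand up to sign. -/
theorem mul_eq_zero_of_tripleIntegral_eq_zero {g : Grassmann}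
    (hg : tripleIntegral (g * gen .f245 * gen .f235 * gen .f125) = 0) :
    g * gen .f245 * gen .f235 * gen .f125 = 0 := by
  have key : ∀ (t : Face) (h : Grassmann), berezin t (h * gen t) * gen t = h * gen t := fun t h => by
    rw [berezin_mul_gen, if_pos rfl, sub_mul, mul_assoc, gen_mul_self, mul_zero, sub_zero]
  have move : ∀ {t s : Face}, s ≠ t → ∀ h : Grassmann,
      berezin t h * gen s = -berezin t (h * gen s) :=
    fun hst h => by rw [berezin_mul_gen_of_ne hst, neg_neg]
  have h1 := congrArg (· * gen .f125 * gen .f235 * gen .f245) hg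
  simp only [zero_mul, tripleIntegral_apply] at h1
  rw [move (by decide), move (by decide), map_neg, key,
    mul_gen_mul_gen (g * gen .f245)] at h1
  simp only [neg_mul, map_neg, neg_neg] at h1
  rw [move (by decide), key, mul_gen_mul_gen g] at h1
  simp only [neg_mul, map_neg, neg_neg, neg_eq_zero] at h1
  rw [mul_gen_mul_gen (g * gen .f125), map_neg, neg_mul, key, neg_eq_zero] at h1
  rw [mul_gen_mul_gen (g * gen .f245), mul_gen_mul_gen g, neg_mul, neg_neg,
    mul_gen_mul_gen (g * gen .f125), h1, neg_zero]

theorem gen_mul_gen_mul_gen_ne_zero :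
    gen .f245 * gen .f235 * gen .f125 ≠ 0 := by
  intro h
  have h1 := congrArg (fun g => berezin .f245 (berezin .f235 (berezin .f125 g))) h
  simp [berezin_mul_gen, berezin_gen] at h1

/-- If the integral of `H` vanished, the linear equations would make it vanish after inserting
`x₂₄₅`, then `x₂₃₅`, then `x₁₂₅`. Then `H x₂₄₅ x₂₃₅ x₁₂₅ = 0`, impossible for invertible `H`. -/
theorem tripleIntegral_ne_zero (p1245 p2345 p1235 : GaussParams)
    (h1245 : p1245.delta ≠ 0) (h1235 : p1235.delta ≠ 0) :
    tripleIntegral (p1245.weight .f124 .f145 .f125 .f245 * p2345.weight .f234 .f245 .f235 .f345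
      * p1235.weight .f125 .f235 .f123 .f135) ≠ 0 := by
  have tA := GaussParams.transforms_weight h1245 (x₁ := .f124) (x₂ := .f145) (y₁ := .f125)
    (y₂ := .f245) (by decide)
  have tC := GaussParams.transforms_weight h1235 (x₁ := .f125) (x₂ := .f235) (y₁ := .f123)
    (y₂ := .f135) (by decide)
  have eB := isGrassmannEven_weight p2345 .f234 .f245 .f235 .f345
  have eC := isGrassmannEven_weight p1235 .f125 .f235 .f123 .f135
  have zA : ∀ t ∉ [Face.f124, .f145, .f125, .f245],
    berezin t (p1245.weight .f124 .f145 .f125 .f245) = 0 := fun t => berezin_weight_of_notMem _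
  have zB : ∀ t ∉ [Face.f234, .f245, .f235, .f345],
    berezin t (p2345.weight .f234 .f245 .f235 .f345) = 0 := fun t => berezin_weight_of_notMem _
  have zC : ∀ t ∉ [Face.f125, .f235, .f123, .f135],
    berezin t (p1235.weight .f125 .f235 .f123 .f135) = 0 := fun t => berezin_weight_of_notMem _
  have uH := ((isUnit_weight p1245 .f124 .f145 .f125 .f245).mul
    (isUnit_weight p2345 .f234 .f245 .f235 .f345)).mul (isUnit_weight p1235 .f125 .f235 .f123 .f135)
  generalize p1245.weight .f124 .f145 .f125 .f245 = A at *
  generalize p2345.weight .f234 .f245 .f235 .f345 = B at *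
  generalize p1235.weight .f125 .f235 .f123 .f135 = C at *
  have dH := fun t => eB.berezin_mul_mul (A := A) eC t
  have d124 : berezin .f124 (A * B * C) = berezin .f124 A * B * C := by
    simp [dH, zB .f124 (by decide), zC .f124 (by decide)]
  have d145 : berezin .f145 (A * B * C) = berezin .f145 A * B * C := by
    simp [dH, zB .f145 (by decide), zC .f145 (by decide)]
  have d123 : berezin .f123 (A * B * C) = A * B * berezin .f123 C := by
    simp [dH, zA .f123 (by decide), zB .f123 (by decide)]
  have d135 : berezin .f135 (A * B * C) = A * B * berezin .f135 C := by
    simp [dH, zA .f135 (by decide), zB .f135 (by decide)]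
  have sA := tA.map_cons (LinearMap.mulRight ℂ C ∘ₗ LinearMap.mulRight ℂ B)
  simp only [LinearMap.comp_apply, LinearMap.mulRight_apply, eB.mul_gen_mul, eC.mul_gen_mul,
    map_neg] at sA
  rw [← d124, ← d145] at sA
  have sC := tC.map_cons (LinearMap.mulLeft ℂ (A * B))
  simp only [LinearMap.mulLeft_apply, ← mul_assoc, map_neg] at sC
  rw [← d123, ← d135] at sC
  generalize A * B * C = H at *
  intro h0
  have x1 := sC 0
  have x2 := sC 2
  simp only [Fin.sum_univ_four, Matrix.cons_val] at x1 x2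
  obtain ⟨y1, y2, -, -⟩ := (GaussParams.transforms_iff h1245 _ _ _ _ _ _ _ _).1 sA
  -- Eliminating `x₁₂₅` between the derivatives in `x₁₂₄` and `x₁₄₅` leaves `x₂₄₅` with coefficient
  -- `Δ`, expressed by external operations only.
  have y : p1245.delta • (H * gen .f245)
      = p1245.b21 • berezin .f124 H - p1245.b11 • berezin .f145 H
        + (p1245.a * p1245.b21) • (H * gen .f145) + (p1245.a * p1245.b11) • (H * gen .f124) := by
    rw [y1, y2, GaussParams.delta]
    module
  have n1 : tripleIntegral (H * gen .f245) = 0 := by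
    have h := congrArg tripleIntegral y
    simp only [map_add, map_sub, map_smul, tripleIntegral_berezin,
      tripleIntegral_mul_gen (s := .f145) (by decide),
      tripleIntegral_mul_gen (s := .f124) (by decide), h0, map_zero, zero_mul, neg_zero,
      smul_zero, sub_zero, add_zero] at h
    exact (smul_eq_zero.1 h).resolve_left h1245
  -- External multiplications and derivatives pass through the integral, so they preserve its
  -- vanishing. By `x1` and `x2`, inserting `x₁₂₅` or `x₂₃₅` amounts to such operations in 123 and
  -- 135.
  have step : ∀ w : Grassmann, tripleIntegral w = 0 →
      (∀ s ∈ [Face.f123, .f135], tripleIntegral (w * gen s) = 0) ∧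
        ∀ s, tripleIntegral (berezin s w) = 0 := by
    intro w hw
    refine ⟨fun s hs => ?_, fun s => ?_⟩
    · simp only [List.mem_cons, List.not_mem_nil, or_false] at hs
      rcases hs with rfl | rfl <;>
        rw [tripleIntegral_mul_gen (by decide), hw, zero_mul, neg_zero]
    · rw [tripleIntegral_berezin, hw, map_zero, neg_zero]
  have n2 : tripleIntegral (H * gen .f245 * gen .f235) = 0 := by
    obtain ⟨m, d⟩ := step _ n1
    have a1 := m .f123 (by decide)
    have a2 := m .f135 (by decide)
    have a3 := d .f123
    have a4 := d .f135
    rw [mul_gen_mul_gen, map_neg, neg_eq_zero] at a1 a2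
    rw [berezin_mul_gen_of_ne (by decide), map_neg, neg_eq_zero] at a3 a4
    rw [mul_gen_mul_gen, x2]
    simp only [add_mul, smul_mul_assoc, neg_mul, map_neg, map_add, map_smul, a1, a2, a3, a4]
    simp
  have n3 : tripleIntegral (H * gen .f245 * gen .f235 * gen .f125) = 0 := by
    obtain ⟨m, d⟩ := step _ n2
    have a1 := m .f123 (by decide)
    have a2 := m .f135 (by decide)
    have a3 := d .f123
    have a4 := d .f135
    rw [mul_gen_mul_gen, mul_gen_mul_gen H, neg_mul, neg_neg] at a1 a2
    rw [berezin_mul_gen_of_ne (by decide), berezin_mul_gen_of_ne (by decide), neg_mul, neg_neg]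
      at a3 a4
    rw [mul_gen_mul_gen, mul_gen_mul_gen H, neg_mul, neg_neg, x1]
    simp only [add_mul, smul_mul_assoc, neg_mul, map_neg, map_add, map_smul, a1, a2, a3, a4]
    simp
  have h := mul_eq_zero_of_tripleIntegral_eq_zero n3
  rw [mul_assoc, mul_assoc, uH.mul_right_eq_zero, ← mul_assoc] at h
  exact gen_mul_gen_mul_gen_ne_zero h

/-! ### The integral over `x₁₃₄` in closed form -/

/-- A factor `exp (c x y)` free of the variable `z` is absorbed into the regular part of
`E exp (g z)`. -/
theorem mul_pairExp_regular {E g : Grassmann} {z : Face} (c : ℂ) (x y : Face) :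
    E * (1 + g * gen z) * pairExp c x y = E * pairExp c x y * (1 + g * gen z) := by
  rw [mul_assoc, ← (isGrassmannEven_pairExp c x y).comm, mul_assoc]

/-- Products of two terms containing `z` vanish, so the coefficients of `z` in the exponent simply
add. -/
theorem mul_pairExp_right {E g : Grassmann} {z : Face} (c : ℂ) (y : Face) :
    E * (1 + g * gen z) * pairExp c y z = E * (1 + (g + c • gen y) * gen z) := by
  have h : g * gen z * (gen y * gen z) = 0 := by
    rw [gen_mul_gen y z, mul_neg, mul_assoc, ← mul_assoc (gen z), gen_mul_self, zero_mul, mul_zero,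
      neg_zero]
  rw [mul_assoc, pairExp, mul_add, mul_one, add_mul 1 (g * gen z), one_mul, mul_smul_comm, h,
    smul_zero, add_zero, add_assoc, add_mul, smul_mul_assoc]

theorem mul_pairExp_left {E g : Grassmann} {z : Face} (c : ℂ) (y : Face) :
    E * (1 + g * gen z) * pairExp c z y = E * (1 + (g - c • gen y) * gen z) := by
  have h : pairExp c z y = pairExp (-c) y z := by
    rw [pairExp, pairExp, gen_mul_gen z y, smul_neg, neg_smul]
  rw [h, mul_pairExp_right, neg_smul, sub_eq_add_neg]

/-- The coefficient of `x₁₃₄` in the exponent of `𝒲₁₂₃₄ 𝒲₁₃₄₅`. -/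
noncomputable def linearPart (p q : GaussParams) : Face →₀ ℂ :=
  Finsupp.single .f124 p.b12 + Finsupp.single .f234 p.b22 + Finsupp.single .f123 p.c
    - Finsupp.single .f145 q.a - Finsupp.single .f135 q.b11 - Finsupp.single .f345 q.b12

theorem smul_gen (c : ℂ) (t : Face) : ExteriorAlgebra.ι ℂ (Finsupp.single t c) = c • gen t := by
  rw [gen, ← map_smul, Finsupp.smul_single, smul_eq_mul, mul_one]

theorem ι_linearPart (p q : GaussParams) :
    ExteriorAlgebra.ι ℂ (linearPart p q) = p.b12 • gen .f124 + p.b22 • gen .f234 + p.c • gen .f123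
      - q.a • gen .f145 - q.b11 • gen .f135 - q.b12 • gen .f345 := by
  simp only [linearPart, map_add, map_sub, smul_gen]

theorem linearPart_ne_zero {p : GaussParams} (hp : p.delta ≠ 0) (q : GaussParams) :
    linearPart p q ≠ 0 := by
  intro h
  have h1 := DFunLike.congr_fun h .f124
  have h2 := DFunLike.congr_fun h .f234
  simp [linearPart] at h1 h2
  -- The coefficients `b₁₂` and `b₂₂` form a column of the determinant `Δ`.
  exact hp (by rw [GaussParams.delta, h1, h2, mul_zero, zero_mul, sub_zero])

/-- The part of `𝒲₁₂₃₄ 𝒲₁₃₄₅` free of the variable `x₁₃₄`. -/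
noncomputable def regularPart (p q : GaussParams) : Grassmann :=
  pairExp p.a .f124 .f234 * pairExp p.b11 .f124 .f123 * pairExp p.b21 .f234 .f123
    * pairExp q.b21 .f145 .f135 * pairExp q.b22 .f145 .f345 * pairExp q.c .f135 .f345

theorem isGrassmannEven_regularPart (p q : GaussParams) : IsGrassmannEven (regularPart p q) :=
  (((((isGrassmannEven_pairExp _ _ _).mul (isGrassmannEven_pairExp _ _ _)).mul
    (isGrassmannEven_pairExp _ _ _)).mul (isGrassmannEven_pairExp _ _ _)).mul
    (isGrassmannEven_pairExp _ _ _)).mul (isGrassmannEven_pairExp _ _ _)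

theorem isUnit_regularPart (p q : GaussParams) : IsUnit (regularPart p q) :=
  (((((isUnit_pairExp _ _ _).mul (isUnit_pairExp _ _ _)).mul
    (isUnit_pairExp _ _ _)).mul (isUnit_pairExp _ _ _)).mul
    (isUnit_pairExp _ _ _)).mul (isUnit_pairExp _ _ _)

theorem berezin_regularPart (t : Face) (p q : GaussParams) :
    berezin t (regularPart p q) = regularPart p q *
      (pairForce t p.a .f124 .f234 + pairForce t p.b11 .f124 .f123 + pairForce t p.b21 .f234 .f123
        + pairForce t q.b21 .f145 .f135 + pairForce t q.b22 .f145 .f345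
        + pairForce t q.c .f135 .f345) := by
  have h := berezin_pairExp t
  have e := isGrassmannEven_pairExp
  exact (e _ _ _).berezin_mul ((e _ _ _).berezin_mul ((e _ _ _).berezin_mul
    ((e _ _ _).berezin_mul ((e _ _ _).berezin_mul (h _ _ _) (h _ _ _)) (h _ _ _))
    (h _ _ _)) (h _ _ _)) (h _ _ _)

theorem weight_mul_weight (p q : GaussParams) :
    p.weight .f124 .f234 .f123 .f134 * q.weight .f134 .f145 .f135 .f345
      = regularPart p q * (1 + ExteriorAlgebra.ι ℂ (linearPart p q) * gen .f134) := by
  have h0 : pairExp p.a .f124 .f234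
      = pairExp p.a .f124 .f234 * (1 + (0 : Grassmann) * gen .f134) := by
    rw [zero_mul, add_zero, mul_one]
  rw [weight_eq, weight_eq, h0]
  simp only [← mul_assoc]
  rw [mul_pairExp_regular, mul_pairExp_right, mul_pairExp_regular, mul_pairExp_right,
    mul_pairExp_right, mul_pairExp_left, mul_pairExp_left, mul_pairExp_left, mul_pairExp_regular,
    mul_pairExp_regular, mul_pairExp_regular, ι_linearPart, zero_add, regularPart]

theorem berezin_weight_mul_weight (p q : GaussParams) :
    berezin .f134 (p.weight .f124 .f234 .f123 .f134 * q.weight .f134 .f145 .f135 .f345)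
      = regularPart p q * ExteriorAlgebra.ι ℂ (linearPart p q) := by
  have h1 : berezin .f134 (regularPart p q) = 0 := by
    rw [berezin_regularPart]
    simp [pairForce]
  have h2 : berezin .f134 (ExteriorAlgebra.ι ℂ (linearPart p q)) = 0 := by
    rw [berezin_ι]
    simp [linearPart]
  rw [weight_mul_weight, mul_add, mul_one, map_add, h1, zero_add, ← mul_assoc, berezin_mul_gen,
    if_pos rfl, (isGrassmannEven_regularPart p q).comm,
    (isGrassmannEven_regularPart p q).leibniz, h1, h2]
  simp

/-! ### Uniqueness of the solution and comparison of both sides -/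

/-- Writing `K = K' E` with `E` the invertible regular part cancels the logarithmic derivative of
`E`, which leaves the system of `exists_eq_smul_ι` for `K'`. -/
theorem eq_smul_regularPart_mul_ι {p q : GaussParams} (hp : p.delta ≠ 0) {K s : Grassmann}
    (hKv : K * ExteriorAlgebra.ι ℂ (linearPart p q) = 0)
    (hK : ∀ t, berezin t K + linearPart p q t • s = K *
      (pairForce t p.a .f124 .f234 + pairForce t p.b11 .f124 .f123 + pairForce t p.b21 .f234 .f123
        + pairForce t q.b21 .f145 .f135 + pairForce t q.b22 .f145 .f345
        + pairForce t q.c .f135 .f345)) :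
    ∃ c : ℂ, K = c • (regularPart p q * ExteriorAlgebra.ι ℂ (linearPart p q)) := by
  have e := isGrassmannEven_regularPart p q
  have u := isUnit_regularPart p q
  have d := fun t => berezin_regularPart t p q
  generalize regularPart p q = E at *
  obtain ⟨K, rfl⟩ : ∃ K', K = K' * E := by
    obtain ⟨F, hF⟩ := u.exists_left_inv
    exact ⟨K * F, by rw [mul_assoc, hF, mul_one]⟩
  obtain ⟨s, rfl⟩ : ∃ s', s = s' * E := by
    obtain ⟨F, hF⟩ := u.exists_left_inv
    exact ⟨s * F, by rw [mul_assoc, hF, mul_one]⟩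
  obtain ⟨c, hc⟩ := exists_eq_smul_ι (K := K) (s := s) (linearPart_ne_zero hp q) (by
    rwa [mul_assoc, e.comm, ← mul_assoc, u.mul_left_eq_zero] at hKv) (fun t => by
    have h := hK t
    rw [e.leibniz, d, ← mul_assoc, add_right_comm, add_eq_right, ← smul_mul_assoc, ← add_mul,
      u.mul_left_eq_zero] at h
    exact eq_neg_of_add_eq_zero_left h)
  exact ⟨c, by rw [hc, e.comm, smul_mul_assoc]⟩

theorem theorem6 (p1234 p1345 p1245 p2345 p1235 : GaussParams)
    (h1234 : p1234.delta ≠ 0) (h1345 : p1345.delta ≠ 0) (h1245 : p1245.delta ≠ 0)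
    (h2345 : p2345.delta ≠ 0) (h1235 : p1235.delta ≠ 0)
    (hW : DirectSumPentagon p1234.mat p1345.mat p1245.mat p2345.mat p1235.mat) :
    ∃ k : ℂ, k ≠ 0 ∧
      GrassmannPentagon
        (p1234.weight .f124 .f234 .f123 .f134)
        (p1345.weight .f134 .f145 .f135 .f345)
        (p1245.weight .f124 .f145 .f125 .f245)
        (p2345.weight .f234 .f245 .f235 .f345)
        (p1235.weight .f125 .f235 .f123 .f135) k := by
  have hne := tripleIntegral_ne_zero p1245 p2345 p1235 h1245 h1235
  have htr := tripleIntegral_transforms p1245 p2345 p1235 h1245 h2345 h1235 rfl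
  have zA : ∀ t ∉ [Face.f124, .f145, .f125, .f245],
    berezin t (p1245.weight .f124 .f145 .f125 .f245) = 0 := fun t => berezin_weight_of_notMem _
  have zB : ∀ t ∉ [Face.f234, .f245, .f235, .f345],
    berezin t (p2345.weight .f234 .f245 .f235 .f345) = 0 := fun t => berezin_weight_of_notMem _
  have zC : ∀ t ∉ [Face.f125, .f235, .f123, .f135],
    berezin t (p1235.weight .f125 .f235 .f123 .f135) = 0 := fun t => berezin_weight_of_notMem _
  have eB := isGrassmannEven_weight p2345 .f234 .f245 .f235 .f345
  have eC := isGrassmannEven_weight p1235 .f125 .f235 .f123 .f135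
  rw [DirectSumPentagon] at hW
  unfold GrassmannPentagon
  rw [berezin_weight_mul_weight, ← tripleIntegral_apply]
  rw [← hW] at htr
  have d134 := eB.berezin_mul_mul (A := p1245.weight .f124 .f145 .f125 .f245) eC .f134
  rw [zA _ (by decide), zB _ (by decide), zC _ (by decide), zero_mul, zero_mul, mul_zero, zero_mul,
    mul_zero, add_zero, add_zero] at d134
  generalize p1245.weight .f124 .f145 .f125 .f245 * p2345.weight .f234 .f245 .f235 .f345
    * p1235.weight .f125 .f235 .f123 .f135 = H at *
  -- The entries `s 2` and `s 3` take the place of multiplication by and differentiation in `x₁₃₄`,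
  -- a variable absent from `H`.
  obtain ⟨s, hz, ho⟩ := exists_sum_smul_of_mul htr
  obtain ⟨t1, z4, z5⟩ := (onSummands12_iff _ _).1 hz
  obtain ⟨t2, s0, s1⟩ := (onSummands23_iff _ _).1 ho
  simp only [Matrix.cons_val, tripleIntegral_berezin, neg_neg,
    tripleIntegral_mul_gen (s := .f123) (by decide),
    tripleIntegral_mul_gen (s := .f124) (by decide),
    tripleIntegral_mul_gen (s := .f135) (by decide),
    tripleIntegral_mul_gen (s := .f145) (by decide),
    tripleIntegral_mul_gen (s := .f234) (by decide),
    tripleIntegral_mul_gen (s := .f345) (by decide)] at t1 t2 z4 z5 s0 s1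
  rw [s0, s1, GaussParams.transforms_iff h1234] at t1
  rw [← z4, ← z5, GaussParams.transforms_iff h1345] at t2
  obtain ⟨a1, a2, a3, a4⟩ := t1
  obtain ⟨b1, b2, b3, b4⟩ := t2
  have i134 := tripleIntegral_berezin .f134 H
  rw [d134, map_zero, eq_comm, neg_eq_zero] at i134
  have i125 := berezin_tripleIntegral (t := .f125) (by decide) H
  have i235 := berezin_tripleIntegral (t := .f235) (by decide) H
  have i245 := berezin_tripleIntegral (t := .f245) (by decide) H
  generalize tripleIntegral H = K at *
  obtain ⟨c, hc⟩ := eq_smul_regularPart_mul_ι (p := p1234) (q := p1345) h1234 (K := K)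
    -- The common sign of the triple integral makes `-s 2` the analogue of `K x₁₃₄`. The two
    -- expressions `a4` and `b1` for `s 3` agree, which says that `K` is annihilated by the linear
    -- form.
    (s := -s 2) (by
      rw [ι_linearPart]
      simp only [mul_add, mul_sub, mul_smul_comm]
      have h := a4.symm.trans b1
      rw [← sub_eq_zero] at h
      rw [← h]
      module) (fun t => by
      have c1 := neg_eq_iff_eq_neg.1 a1
      have c2 := neg_eq_iff_eq_neg.1 a2
      have c4 := neg_eq_iff_eq_neg.1 b2
      cases t <;> simp only [i134, i125, i235, i245, a3, b3, b4, c1, c2, c4] <;>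
        simp [pairForce, linearPart, mul_add] <;> module)
  refine ⟨c⁻¹, inv_ne_zero ?_, ?_⟩
  · rintro rfl
    exact hne (by rw [hc, zero_smul])
  · rw [hc, smul_smul, inv_mul_cancel₀, one_smul]
    rintro rfl
    exact hne (by rw [hc, zero_smul])
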